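/- **Syntax.** Let $\Sigma$ be a set of actions and $T$ a finite set of primitive tests. Boolean expressions are given by $b,c ::= 0 \mid 1 \mid t\in T \mid b\cdot c \mid b+c \mid \bar b$, and GKAT expressions by $e,f ::= p\in\Sigma \mid b \mid e\cdot f \mid e+_b f \mid e^{(b)}$; every Boolean expression is a GKAT expression, and on Boolean expressions the two products $\cdot$ are the same operation. Let $\equiv_{\mathrm{BA}}$ be equivalence of Boolean expressions by the axioms of Boolean algebra. **Language model.** Let $\mathrm{At}$ be the set of atoms (truth assignments on $T$), with $\alpha\le b$ if $b$ is true under $\alpha$. Guarded strings are the words $\alpha_0p_1\alpha_1\cdots p_n\alpha_n$ with $\alpha_i\in\mathrm{At}$, $p_i\in\Sigma$; $x\alpha\diamond\beta y = x\alpha y$ if $\alpha=\beta$ and is undefined otherwise, and $L\diamond K=\{x\diamond y : x\in L,\ y\in K\}$, $L^0=\mathrm{At}$, $L^{n+1}=L^n\diamond L$. Put $⟦p⟧=\{\alpha p\beta : \alpha,\beta\in\mathrm{At}\}$, $⟦b⟧=\{\alpha\in\mathrm{At} : \alpha\le b\}$, $⟦e\cdot f⟧=⟦e⟧\diamond⟦f⟧$,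 $⟦e+_bf⟧=(⟦b⟧\diamond⟦e⟧)\cup(⟦\bar b⟧\diamond⟦f⟧)$, $⟦e^{(b)}⟧=\bigcup_{n\ge0}(⟦b⟧\diamond⟦e⟧)^n\diamond⟦\bar b⟧$. **Axioms.** Let $E(b)=b$, $E(p)=0$, $E(e\cdot f)=E(e)\cdot E(f)$, $E(e+_bf)=b\cdot E(e)+\bar b\cdot E(f)$, $E(e^{(b)})=\bar b$. The GKAT axioms for a congruence $\equiv$ on GKAT expressions are: $b\equiv_{\mathrm{BA}}c$ implies $b\equiv c$; $e+_be\equiv e$; $e+_bf\equiv f+_{\bar b}e$; $(e+_bf)+_cg\equiv e+_{bc}(f+_cg)$; $e+_bf\equiv be+_bf$; $eg+_bfg\equiv(e+_bf)g$; $(ef)g\equiv e(fg)$; $0e\equiv0$; $e0\equiv0$; $1e\equiv e$; $e1\equiv e$; $e^{(b)}\equiv ee^{(b)}+_b1$; $(e+_c1)^{(b)}\equiv(ce)^{(b)}$; and if $E(e)\equiv0$ and $g\equiv eg+_bf$, then $g\equiv e^{(b)}f$. **Uniqueness axiom.** A system of left-affine equations consists of equations $x_i=e_{i1}x_1+_{b_{i1}}(\cdots+_{b_{i(n-1)}}(e_{in}x_n+_{b_{in}}d_i))$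 for $1\le i\le n$, with GKAT expressions $e_{ij}$ and Boolean expressions $b_{ij},d_i$ such that $b_{ij}b_{ik}\equiv_{\mathrm{BA}}0$ for $j\ne k$ and $b_{ij}d_i\equiv_{\mathrm{BA}}0$. A solution assigns to each $x_i$ an expression $s(x_i)$ such that all equations hold up to $\equiv$. The system is Salomaa if $E(e_{ij})\equiv0$ for all $i,j$. The uniqueness axiom for $\equiv$ says: if $s$ and $s'$ are solutions of a Salomaa system, then $s(x_i)\equiv s'(x_i)$ for all $i$. **Theorem (Completeness).** The GKAT axioms together with the uniqueness axiom are complete for the language model: if $\equiv$ is the smallest congruence on GKAT expressions that satisfies the GKAT axioms and the uniqueness axiom, then for all $e_1,e_2$, $$⟦e_1⟧=⟦e_2⟧\ \Longrightarrow\ e_1\equiv e_2 .$$ Likewise, if the smallest congruence $\equiv$ that satisfies the GKAT axioms alone happens to satisfy the uniqueness axiom, then $⟦e_1⟧=⟦e_2⟧$ implies $e_1\equiv e_2$ for all $e_1,e_2$. -/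

import Mathlib

namespace GKAT

universe u v

/-! ### Syntax -/

/-- Boolean expressions over the primitive tests `T`. -/
inductive BExp (T : Type v) : Type v
  | zero : BExp T
  | one : BExp T
  | prim (t : T) : BExp T
  | and (b c : BExp T) : BExp T
  | or (b c : BExp T) : BExp T
  | not (b : BExp T) : BExp T

/-- GKAT expressions over the actions `A` and the primitive tests `T`.
`cond b e f` is the guarded union `e +_b f`, and `loop b e` is the guarded loop `e^(b)`. -/
inductive Exp (A : Type u) (T : Type v) : Type (max u v)
  | act (p : A) : Exp A T
  | test (b : BExp T) : Exp A T
  | seq (e f : Exp A T) : Exp A T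
  | cond (b : BExp T) (e f : Exp A T) : Exp A T
  | loop (b : BExp T) (e : Exp A T) : Exp A T

/-- Boolean equivalence: the smallest congruence on Boolean expressions that satisfies the
axioms of Boolean algebra (complemented distributive lattices). -/
inductive BAEquiv {T : Type v} : BExp T → BExp T → Prop
  | refl (b : BExp T) : BAEquiv b b
  | symm {b c : BExp T} : BAEquiv b c → BAEquiv c b
  | trans {b c d : BExp T} : BAEquiv b c → BAEquiv c d → BAEquiv b d
  | and_congr {b b' c c' : BExp T} :
      BAEquiv b b' → BAEquiv c c' → BAEquiv (.and b c) (.and b' c')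
  | or_congr {b b' c c' : BExp T} :
      BAEquiv b b' → BAEquiv c c' → BAEquiv (.or b c) (.or b' c')
  | not_congr {b b' : BExp T} : BAEquiv b b' → BAEquiv (.not b) (.not b')
  | and_comm (b c : BExp T) : BAEquiv (.and b c) (.and c b)
  | or_comm (b c : BExp T) : BAEquiv (.or b c) (.or c b)
  | and_assoc (b c d : BExp T) : BAEquiv (.and (.and b c) d) (.and b (.and c d))
  | or_assoc (b c d : BExp T) : BAEquiv (.or (.or b c) d) (.or b (.or c d))
  | and_absorb (b c : BExp T) : BAEquiv (.and b (.or b c)) b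
  | or_absorb (b c : BExp T) : BAEquiv (.or b (.and b c)) b
  | and_distrib (b c d : BExp T) :
      BAEquiv (.and b (.or c d)) (.or (.and b c) (.and b d))
  | or_distrib (b c d : BExp T) :
      BAEquiv (.or b (.and c d)) (.and (.or b c) (.or b d))
  | and_one (b : BExp T) : BAEquiv (.and b .one) b
  | or_zero (b : BExp T) : BAEquiv (.or b .zero) b
  | and_not (b : BExp T) : BAEquiv (.and b (.not b)) .zero
  | or_not (b : BExp T) : BAEquiv (.or b (.not b)) .one

/-! ### The language model -/

/-- Atoms of the free Boolean algebra on the finite set `T`, as truth assignments on `T`. -/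
abbrev Atom (T : Type v) : Type v := T → Bool

/-- `BExp.eval α b = true` says that the atom `α` lies below `b`. -/
def BExp.eval {T : Type v} (α : Atom T) : BExp T → Bool
  | .zero => false
  | .one => true
  | .prim t => α t
  | .and b c => b.eval α && c.eval α
  | .or b c => b.eval α || c.eval α
  | .not b => !(b.eval α)

/-- Guarded strings `α₀ p₁ α₁ ⋯ pₙ αₙ`, stored as `first = α₀` and
`steps = [(p₁, α₁), …, (pₙ, αₙ)]`. -/
@[ext]
structure GString (A : Type u) (T : Type v) : Type (max u v) where
  first : Atom T
  steps : List (A × Atom T)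

/-- The last atom of a guarded string. -/
def GString.last {A : Type u} {T : Type v} (w : GString A T) : Atom T :=
  w.steps.foldl (fun _ s => s.2) w.first

/-- The guarded string consisting of a single atom. -/
def GString.ofAtom {A : Type u} {T : Type v} (α : Atom T) : GString A T := ⟨α, []⟩

/-- Languages of guarded strings. -/
abbrev Lang (A : Type u) (T : Type v) : Type (max u v) := Set (GString A T)

/-- The set of guarded strings given by a set of atoms. -/
def Lang.ofAtoms {A : Type u} {T : Type v} (B : Set (Atom T)) : Lang A T :=
  GString.ofAtom '' B

/-- Fusion product of languages: `xα ⋄ βy` is `xαy` if `α = β` and undefined otherwise. -/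
def Lang.fusion {A : Type u} {T : Type v} (L K : Lang A T) : Lang A T :=
  {w | ∃ x ∈ L, ∃ y ∈ K, x.last = y.first ∧ w = ⟨x.first, x.steps ++ y.steps⟩}

/-- Powers with respect to the fusion product: `L⁰ = At` and `Lⁿ⁺¹ = Lⁿ ⋄ L`. -/
def Lang.power {A : Type u} {T : Type v} (L : Lang A T) : ℕ → Lang A T
  | 0 => Lang.ofAtoms Set.univ
  | n + 1 => (Lang.power L n).fusion L

/-- Guarded union of languages: `L +_B K = (B ⋄ L) ∪ (Bᶜ ⋄ K)`. -/
def Lang.cond {A : Type u} {T : Type v} (B : Set (Atom T)) (L K : Lang A T) : Lang A T :=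
  (Lang.ofAtoms B).fusion L ∪ (Lang.ofAtoms Bᶜ).fusion K

/-- Guarded iteration of languages: `L^(B) = ⋃ₙ (B ⋄ L)ⁿ ⋄ Bᶜ`. -/
def Lang.loop {A : Type u} {T : Type v} (B : Set (Atom T)) (L : Lang A T) : Lang A T :=
  ⋃ n : ℕ, (((Lang.ofAtoms B).fusion L).power n).fusion (Lang.ofAtoms Bᶜ)

/-- The set of atoms below a Boolean expression. -/
def BExp.atoms {T : Type v} (b : BExp T) : Set (Atom T) := {α | b.eval α = true}

/-- The language semantics `⟦e⟧` of a GKAT expression. -/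
def Exp.sem {A : Type u} {T : Type v} : Exp A T → Lang A T
  | .act p => {w | ∃ α β : Atom T, w = ⟨α, [(p, β)]⟩}
  | .test b => Lang.ofAtoms b.atoms
  | .seq e f => e.sem.fusion f.sem
  | .cond b e f => Lang.cond b.atoms e.sem f.sem
  | .loop b e => Lang.loop b.atoms e.sem

/-! ### The axioms -/

/-- The Boolean expression `E(e)`: the weakest test under which `e` terminates successfully
without performing an action. -/
def Exp.E {A : Type u} {T : Type v} : Exp A T → BExp T
  | .act _ => .zero
  | .test b => b
  | .seq e f => .and e.E f.E
  | .cond b e f => .or (.and b e.E) (.and (.not b) f.E)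
  | .loop b _ => .not b

/-- `R` is a congruence on GKAT expressions that subsumes Boolean equivalence and satisfies the
GKAT axioms (U1–U5, S1–S5, W1–W3). Boolean expressions form a subset of the GKAT expressions on
which the conjunction of tests and sequential composition are one and the same operation; as
`Exp.test` is a constructor here, this is the clause `test_seq`. -/
structure IsGKATCongruence {A : Type u} {T : Type v} (R : Exp A T → Exp A T → Prop) : Prop where
  equivalence : Equivalence R
  seq_congr : ∀ {e e' f f'}, R e e' → R f f' → R (.seq e f) (.seq e' f')
  cond_congr : ∀ {b e e' f f'}, R e e' → R f f' → R (.cond b e f) (.cond b e' f')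
  loop_congr : ∀ {b e e'}, R e e' → R (.loop b e) (.loop b e')
  test_of_baEquiv : ∀ {b c}, BAEquiv b c → R (.test b) (.test c)
  test_seq : ∀ b c, R (.seq (.test b) (.test c)) (.test (.and b c))
  u1 : ∀ b e, R (.cond b e e) e
  u2 : ∀ b e f, R (.cond b e f) (.cond (.not b) f e)
  u3 : ∀ b c e f g, R (.cond c (.cond b e f) g) (.cond (.and b c) e (.cond c f g))
  u4 : ∀ b e f, R (.cond b e f) (.cond b (.seq (.test b) e) f)
  u5 : ∀ b e f g, R (.cond b (.seq e g) (.seq f g)) (.seq (.cond b e f) g)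
  s1 : ∀ e f g, R (.seq (.seq e f) g) (.seq e (.seq f g))
  s2 : ∀ e, R (.seq (.test .zero) e) (.test .zero)
  s3 : ∀ e, R (.seq e (.test .zero)) (.test .zero)
  s4 : ∀ e, R (.seq (.test .one) e) e
  s5 : ∀ e, R (.seq e (.test .one)) e
  w1 : ∀ b e, R (.loop b e) (.cond b (.seq e (.loop b e)) (.test .one))
  w2 : ∀ b c e, R (.loop b (.cond c e (.test .one))) (.loop b (.seq (.test c) e))
  w3 : ∀ {b e f g}, R (.test e.E) (.test .zero) →
    R g (.cond b (.seq e g) f) → R g (.seq (.loop b e) f)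

/-- `e ≡ f`: the smallest congruence that subsumes Boolean equivalence and satisfies the GKAT
axioms. -/
def GEquiv {A : Type u} {T : Type v} (e f : Exp A T) : Prop :=
  ∀ R : Exp A T → Exp A T → Prop, IsGKATCongruence R → R e f

/-! ### Systems of left-affine equations -/

/-- A system of `n` left-affine equations in the variables `x₁, …, xₙ`,
`xᵢ = eᵢ₁ x₁ +_{bᵢ₁} (⋯ +_{bᵢ₍ₙ₋₁₎} (eᵢₙ xₙ +_{bᵢₙ} dᵢ))`,
where in every row the guards are pairwise disjoint. -/
structure LeftAffineSystem (A : Type u) (T : Type v) (n : ℕ) : Type (max u v) where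
  coeff : Fin n → Fin n → Exp A T
  guard : Fin n → Fin n → BExp T
  const : Fin n → BExp T
  guard_disjoint : ∀ i j k, j ≠ k → BAEquiv (.and (guard i j) (guard i k)) .zero
  const_disjoint : ∀ i j, BAEquiv (.and (guard i j) (const i)) .zero

/-- The right-hand side of the `i`-th equation with `s j` substituted for the `j`-th variable. -/
def LeftAffineSystem.rhs {A : Type u} {T : Type v} {n : ℕ} (S : LeftAffineSystem A T n)
    (s : Fin n → Exp A T) (i : Fin n) : Exp A T :=
  (List.finRange n).foldr (fun j acc => .cond (S.guard i j) (.seq (S.coeff i j) (s j)) acc)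
    (.test (S.const i))

/-- `s` is a solution of the system up to the relation `R`. -/
def LeftAffineSystem.IsSolution {A : Type u} {T : Type v} {n : ℕ} (S : LeftAffineSystem A T n)
    (R : Exp A T → Exp A T → Prop) (s : Fin n → Exp A T) : Prop :=
  ∀ i, R (s i) (S.rhs s i)

/-- A system is Salomaa (up to the relation `R`) if every coefficient `e` satisfies `E(e) ≡ 0`. -/
def LeftAffineSystem.IsSalomaa {A : Type u} {T : Type v} {n : ℕ} (S : LeftAffineSystem A T n)
    (R : Exp A T → Exp A T → Prop) : Prop :=
  ∀ i j, R (.test (S.coeff i j).E) (.test .zero)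

/-- The uniqueness axiom for the relation `R`: every Salomaa system has at most one solution,
modulo `R`. -/
def UniquenessAxiom {A : Type u} {T : Type v} (R : Exp A T → Exp A T → Prop) : Prop :=
  ∀ (n : ℕ) (S : LeftAffineSystem A T n), S.IsSalomaa R →
    ∀ s s' : Fin n → Exp A T, S.IsSolution R s → S.IsSolution R s' → ∀ i, R (s i) (s' i)

/-- Provable equivalence from the GKAT axioms together with the uniqueness axiom: the smallest
congruence that subsumes Boolean equivalence, satisfies the GKAT axioms and is closed under the
uniqueness axiom. -/
def GEquivUA {A : Type u} {T : Type v} (e f : Exp A T) : Prop :=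
  ∀ R : Exp A T → Exp A T → Prop, IsGKATCongruence R → UniquenessAxiom R → R e f

/-- An intersection of congruences satisfying the GKAT axioms is again one, so that a smallest
one exists. -/
theorem isGKATCongruence_sInter {A : Type u} {T : Type v}
    (P : (Exp A T → Exp A T → Prop) → Prop) :
    IsGKATCongruence (fun e f : Exp A T => ∀ R, IsGKATCongruence R → P R → R e f) where
  equivalence :=
    ⟨fun e _ hR _ => hR.equivalence.refl e,
     fun h R hR hP => hR.equivalence.symm (h R hR hP),
     fun h h' R hR hP => hR.equivalence.trans (h R hR hP) (h' R hR hP)⟩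
  seq_congr h h' R hR hP := hR.seq_congr (h R hR hP) (h' R hR hP)
  cond_congr h h' R hR hP := hR.cond_congr (h R hR hP) (h' R hR hP)
  loop_congr h R hR hP := hR.loop_congr (h R hR hP)
  test_of_baEquiv h _ hR _ := hR.test_of_baEquiv h
  test_seq b c _ hR _ := hR.test_seq b c
  u1 b e _ hR _ := hR.u1 b e
  u2 b e f _ hR _ := hR.u2 b e f
  u3 b c e f g _ hR _ := hR.u3 b c e f g
  u4 b e f _ hR _ := hR.u4 b e f
  u5 b e f g _ hR _ := hR.u5 b e f g
  s1 e f g _ hR _ := hR.s1 e f g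
  s2 e _ hR _ := hR.s2 e
  s3 e _ hR _ := hR.s3 e
  s4 e _ hR _ := hR.s4 e
  s5 e _ hR _ := hR.s5 e
  w1 b e _ hR _ := hR.w1 b e
  w2 b c e _ hR _ := hR.w2 b c e
  w3 h h' R hR hP := hR.w3 (h R hR hP) (h' R hR hP)

theorem isGKATCongruence_gEquiv {A : Type u} {T : Type v} :
    IsGKATCongruence (GEquiv (A := A) (T := T)) := by
  have h := isGKATCongruence_sInter (A := A) (T := T) (fun _ => True)
  simp only [forall_const] at h
  exact h

theorem isGKATCongruence_gEquivUA {A : Type u} {T : Type v} :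
    IsGKATCongruence (GEquivUA (A := A) (T := T)) :=
  isGKATCongruence_sInter UniquenessAxiom

theorem uniquenessAxiom_gEquivUA {A : Type u} {T : Type v} :
    UniquenessAxiom (GEquivUA (A := A) (T := T)) :=
  fun n S hS s s' hs hs' i R hR hU =>
    hU n S (fun i j => hS i j R hR hU) s s' (fun i => hs i R hR hU) (fun i => hs' i R hR hU) i

end GKAT

namespace GKAT

universe u v

variable {A : Type u} {T : Type v}

/-! Both claims are instances of `UniquenessAxiom.complete`, which concerns an arbitrary congruence
`R` that satisfies the GKAT axioms and the uniqueness axiom. The work is done in the quotient by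
`R`, a monoid with zero. As `T` is finite, every atom is itself a test, and a class is determined by
its restrictions to the atoms (`ext_atom`). At an atom, an expression equals its derivative: it
fails, succeeds, or does one action and continues (`atom_mul_cls`); the same derivatives compute the
language (`Exp.mem_sem_iff`). Iterated derivatives form a finite set, so an expression is a state of
a finite deterministic automaton. The equations of such an automaton form a Salomaa system, whence a
finite bisimulation up to `R` lies in `R` (`eq_of_bisimulation`). Pairs of derivatives with equal
languages almost form a bisimulation. The one obstacle is that one side may reject where the other
steps into an expression with empty language; such expressions are first shown to be `0`
(`cls_eq_zero`), by comparing them with the constant solution `0`. -/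

/-! ### Completeness of the Boolean axioms -/

/-- Provable Boolean equivalence as a setoid. -/
def baSetoid (T : Type v) : Setoid (BExp T) where
  r := BAEquiv
  iseqv := ⟨BAEquiv.refl, BAEquiv.symm, BAEquiv.trans⟩

/-- The Lindenbaum algebra of Boolean expressions. -/
def Lindenbaum (T : Type v) : Type v := Quotient (baSetoid T)

namespace Lindenbaum

/-- The class of a Boolean expression. -/
def mk (b : BExp T) : Lindenbaum T := Quotient.mk (baSetoid T) b

theorem mk_eq_mk {b c : BExp T} : mk b = mk c ↔ BAEquiv b c := Quotient.eq (r := baSetoid T)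

instance : Max (Lindenbaum T) :=
  ⟨Quotient.map₂ BExp.or fun _ _ h _ _ h' => BAEquiv.or_congr h h'⟩

instance : Min (Lindenbaum T) :=
  ⟨Quotient.map₂ BExp.and fun _ _ h _ _ h' => BAEquiv.and_congr h h'⟩

instance : Lattice (Lindenbaum T) :=
  Lattice.mk'
    (by rintro ⟨a⟩ ⟨b⟩; exact mk_eq_mk.2 (.or_comm a b))
    (by rintro ⟨a⟩ ⟨b⟩ ⟨c⟩; exact mk_eq_mk.2 (.or_assoc a b c))
    (by rintro ⟨a⟩ ⟨b⟩; exact mk_eq_mk.2 (.and_comm a b))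
    (by rintro ⟨a⟩ ⟨b⟩ ⟨c⟩; exact mk_eq_mk.2 (.and_assoc a b c))
    (by rintro ⟨a⟩ ⟨b⟩; exact mk_eq_mk.2 (.or_absorb a b))
    (by rintro ⟨a⟩ ⟨b⟩; exact mk_eq_mk.2 (.and_absorb a b))

theorem mk_or (b c : BExp T) : mk (.or b c) = mk b ⊔ mk c := rfl

theorem mk_and (b c : BExp T) : mk (.and b c) = mk b ⊓ mk c := rfl

instance : DistribLattice (Lindenbaum T) where
  le_sup_inf := by
    rintro ⟨a⟩ ⟨b⟩ ⟨c⟩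
    exact (mk_eq_mk.2 (BAEquiv.or_distrib a b c)).ge

instance : BoundedOrder (Lindenbaum T) where
  top := mk .one
  bot := mk .zero
  le_top := by rintro ⟨a⟩; exact inf_eq_left.1 (mk_eq_mk.2 (.and_one a))
  bot_le := by rintro ⟨a⟩; exact sup_eq_left.1 (mk_eq_mk.2 (.or_zero a))

theorem mk_zero : mk (.zero : BExp T) = ⊥ := rfl

theorem mk_one : mk (.one : BExp T) = ⊤ := rfl

theorem mk_and_not (b : BExp T) : mk b ⊓ mk (.not b) = ⊥ := mk_eq_mk.2 (.and_not b)

theorem mk_or_not (b : BExp T) : mk b ⊔ mk (.not b) = ⊤ := mk_eq_mk.2 (.or_not b)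

/-- A prime ideal determines an atom that decides membership of every expression. -/
theorem exists_atom_of_isPrime (I : Order.Ideal (Lindenbaum T)) (hI : I.IsPrime) :
    ∃ α : Atom T, ∀ b : BExp T, b.eval α = true ↔ mk b ∉ I := by
  classical
  have htop : (⊤ : Lindenbaum T) ∉ I := hI.toIsProper.top_notMem
  obtain ⟨α, hα⟩ : ∃ α : Atom T, ∀ t, α t = true ↔ mk (.prim t) ∉ I :=
    ⟨fun t => decide (mk (.prim t) ∉ I), by simp⟩
  refine ⟨α, fun b => ?_⟩
  induction b with
  | zero => simp [BExp.eval, mk_zero]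
  | one => simpa [BExp.eval, mk_one] using htop
  | prim t => exact hα t
  | and b c ihb ihc =>
    rw [mk_and, BExp.eval, Bool.and_eq_true, ihb, ihc, ← not_or, not_iff_not]
    exact ⟨fun h => h.elim (I.lower inf_le_left) (I.lower inf_le_right), hI.mem_or_mem⟩
  | or b c ihb ihc =>
    rw [mk_or, BExp.eval, Bool.or_eq_true, ihb, ihc, ← not_and_or, not_iff_not]
    exact ⟨fun h => Order.Ideal.sup_mem h.1 h.2,
      fun h => ⟨I.lower le_sup_left h, I.lower le_sup_right h⟩⟩
  | not b ih =>
    rw [BExp.eval, Bool.not_eq_true', ← Bool.not_eq_true, ih, not_not]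
    refine ⟨fun h h' => htop ?_, fun h => ?_⟩
    · rw [← mk_or_not b]
      exact Order.Ideal.sup_mem h h'
    · have : mk b ⊓ mk (.not b) ∈ I := by
        rw [mk_and_not]
        exact I.bot_mem
      exact (hI.mem_or_mem this).resolve_right h

/-- If the inequality fails, the filter above `mk b` misses the ideal below `mk c`. A prime ideal
separating the two yields an atom at which `b` is true and `c` is false. -/
theorem mk_le_mk_of_eval {b c : BExp T} (h : ∀ α, b.eval α = true → c.eval α = true) :
    mk b ≤ mk c := by
  by_contra hbc
  obtain ⟨I, hI, hc, hb⟩ := DistribLattice.prime_ideal_of_disjoint_filter_ideal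
    (F := Order.PFilter.principal (mk b)) (I := Order.Ideal.principal (mk c)) (by
      rw [Set.disjoint_left]
      intro x hx hx'
      exact hbc (le_trans hx hx'))
  obtain ⟨α, hα⟩ := exists_atom_of_isPrime I hI
  refine (hα c).1 (h α ((hα b).2 fun hbI => ?_)) (hc (Order.Ideal.mem_principal_self))
  exact Set.disjoint_left.1 hb (le_refl (mk b)) hbI

end Lindenbaum

/-- Boolean expressions with the same truth table are provably equivalent. -/
theorem BAEquiv.of_eval {b c : BExp T} (h : ∀ α, b.eval α = c.eval α) : BAEquiv b c :=
  Lindenbaum.mk_eq_mk.1 (le_antisymm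
    (Lindenbaum.mk_le_mk_of_eval fun α hb => h α ▸ hb)
    (Lindenbaum.mk_le_mk_of_eval fun α hc => (h α).symm ▸ hc))

theorem BExp.exists_eval_iff_eq [Finite T] (α : Atom T) :
    ∃ b : BExp T, ∀ β, b.eval β = true ↔ β = α := by
  classical
  have := Fintype.ofFinite T
  suffices h : ∀ s : Finset T, ∃ b : BExp T, ∀ β, b.eval β = true ↔ ∀ t ∈ s, β t = α t by
    obtain ⟨b, hb⟩ := h Finset.univ
    exact ⟨b, fun β => by simp [hb, funext_iff]⟩
  intro s
  induction s using Finset.induction_on with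
  | empty => exact ⟨.one, by simp [BExp.eval]⟩
  | insert t s _ ih =>
    obtain ⟨b, hb⟩ := ih
    cases ht : α t with
    | true => exact ⟨.and (.prim t) b, fun β => by simp [BExp.eval, hb, ht]⟩
    | false => exact ⟨.and (.not (.prim t)) b, fun β => by simp [BExp.eval, hb, ht]⟩

/-- A Boolean expression that is true under exactly one atom. -/
noncomputable def Atom.toBExp [Finite T] (α : Atom T) : BExp T :=
  (BExp.exists_eval_iff_eq α).choose

theorem Atom.eval_toBExp [Finite T] (α β : Atom T) :
    (Atom.toBExp α).eval β = true ↔ β = α :=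
  (BExp.exists_eval_iff_eq α).choose_spec β

/-! ### The quotient algebra of a congruence -/

variable {R : Exp A T → Exp A T → Prop}

namespace IsGKATCongruence

/-- The setoid of a congruence. -/
def toSetoid (hR : IsGKATCongruence R) : Setoid (Exp A T) := ⟨R, hR.equivalence⟩

/-- GKAT expressions modulo a congruence. -/
def Quo (hR : IsGKATCongruence R) : Type (max u v) := Quotient hR.toSetoid

/-- The class of an expression. -/
def cls (hR : IsGKATCongruence R) (e : Exp A T) : hR.Quo := Quotient.mk hR.toSetoid e

/-- The class of a test. -/
def tst (hR : IsGKATCongruence R) (b : BExp T) : hR.Quo := hR.cls (.test b)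

variable (hR : IsGKATCongruence R)

theorem cls_eq_cls {e f : Exp A T} : hR.cls e = hR.cls f ↔ R e f := Quotient.eq (r := hR.toSetoid)

/-- The sequencing axioms `s1` to `s5` are exactly these laws, so that `≡`-reasoning becomes
rewriting. -/
instance : MonoidWithZero hR.Quo where
  mul := Quotient.map₂ Exp.seq fun _ _ h _ _ h' => hR.seq_congr h h'
  one := hR.tst .one
  zero := hR.tst .zero
  mul_assoc := by rintro ⟨a⟩ ⟨b⟩ ⟨c⟩; exact hR.cls_eq_cls.2 (hR.s1 a b c)
  one_mul := by rintro ⟨a⟩; exact hR.cls_eq_cls.2 (hR.s4 a)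
  mul_one := by rintro ⟨a⟩; exact hR.cls_eq_cls.2 (hR.s5 a)
  zero_mul := by rintro ⟨a⟩; exact hR.cls_eq_cls.2 (hR.s2 a)
  mul_zero := by rintro ⟨a⟩; exact hR.cls_eq_cls.2 (hR.s3 a)

/-- Guarded union on the quotient. -/
def gu (b : BExp T) : hR.Quo → hR.Quo → hR.Quo :=
  Quotient.map₂ (Exp.cond b) fun _ _ h _ _ h' => hR.cond_congr h h'

theorem cls_seq (e f : Exp A T) : hR.cls (.seq e f) = hR.cls e * hR.cls f := rfl

theorem cls_cond (b : BExp T) (e f : Exp A T) :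
    hR.cls (.cond b e f) = hR.gu b (hR.cls e) (hR.cls f) := rfl

theorem cls_test (b : BExp T) : hR.cls (.test b) = hR.tst b := rfl

theorem tst_zero : hR.tst .zero = 0 := rfl

theorem tst_one : hR.tst .one = 1 := rfl

theorem tst_congr {b c : BExp T} (h : ∀ α, b.eval α = c.eval α) : hR.tst b = hR.tst c :=
  hR.cls_eq_cls.2 (hR.test_of_baEquiv (.of_eval h))

theorem tst_eq_zero {b : BExp T} (h : ∀ α, b.eval α = false) : hR.tst b = 0 :=
  hR.tst_congr h

theorem tst_mul_tst (b c : BExp T) : hR.tst b * hR.tst c = hR.tst (.and b c) :=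
  hR.cls_eq_cls.2 (hR.test_seq b c)

theorem gu_self (b : BExp T) (x : hR.Quo) : hR.gu b x x = x := by
  rcases x with ⟨x⟩; exact hR.cls_eq_cls.2 (hR.u1 b x)

theorem gu_not (b : BExp T) (x y : hR.Quo) : hR.gu (.not b) y x = hR.gu b x y := by
  rcases x with ⟨x⟩; rcases y with ⟨y⟩; exact (hR.cls_eq_cls.2 (hR.u2 b x y)).symm

theorem gu_gu (b c : BExp T) (x y z : hR.Quo) :
    hR.gu c (hR.gu b x y) z = hR.gu (.and b c) x (hR.gu c y z) := by
  rcases x with ⟨x⟩; rcases y with ⟨y⟩; rcases z with ⟨z⟩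
  exact hR.cls_eq_cls.2 (hR.u3 b c x y z)

theorem gu_tst_left (b : BExp T) (x y : hR.Quo) :
    hR.gu b (hR.tst b * x) y = hR.gu b x y := by
  rcases x with ⟨x⟩; rcases y with ⟨y⟩; exact (hR.cls_eq_cls.2 (hR.u4 b x y)).symm

theorem gu_tst_right (b : BExp T) (x y : hR.Quo) :
    hR.gu b x (hR.tst (.not b) * y) = hR.gu b x y := by
  rw [← gu_not, gu_tst_left, gu_not]

/-- This turns restriction to a test into a guarded union, to which the axioms for unions apply.
Split `b x` along `b`: the left branch absorbs `b`, and the right one acquires the negation of `b`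
and vanishes. -/
theorem tst_mul_eq_gu (b : BExp T) (x : hR.Quo) : hR.tst b * x = hR.gu b x 0 := by
  have h : hR.tst (.not b) * hR.tst b = 0 := by
    rw [tst_mul_tst]; exact hR.tst_eq_zero fun α => by simp [BExp.eval]
  calc hR.tst b * x = hR.gu b (hR.tst b * x) (hR.tst (.not b) * (hR.tst b * x)) := by
        rw [gu_tst_right, gu_self]
    _ = hR.gu b x 0 := by rw [gu_tst_left, ← mul_assoc, h, zero_mul]

theorem tst_mul_gu_self (b : BExp T) (x y : hR.Quo) :
    hR.tst b * hR.gu b x y = hR.tst b * x := by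
  have h : hR.tst (.not (.and b b)) * hR.tst b = 0 := by
    rw [tst_mul_tst]; exact hR.tst_eq_zero fun α => by simp [BExp.eval]
  calc hR.tst b * hR.gu b x y = hR.gu (.and b b) x (hR.tst b * y) := by
        rw [tst_mul_eq_gu, gu_gu, ← tst_mul_eq_gu]
    _ = hR.gu (.and b b) x 0 := by
        rw [← gu_tst_right, ← mul_assoc, h, zero_mul]
    _ = hR.tst b * x := by
        rw [← tst_mul_eq_gu, hR.tst_congr (c := b) fun α => by simp [BExp.eval]]

theorem tst_mul_gu_of_le {a b : BExp T} (h : ∀ α, a.eval α = true → b.eval α = true)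
    (x y : hR.Quo) : hR.tst a * hR.gu b x y = hR.tst a * x := by
  have hab : hR.tst a = hR.tst a * hR.tst b := by
    rw [tst_mul_tst]
    refine hR.tst_congr fun α => ?_
    cases ha : a.eval α <;> simp [BExp.eval, ha, h]
  rw [hab, mul_assoc, tst_mul_gu_self, ← mul_assoc]

theorem tst_mul_gu_of_le_not {a b : BExp T} (h : ∀ α, a.eval α = true → b.eval α = false)
    (x y : hR.Quo) : hR.tst a * hR.gu b x y = hR.tst a * y := by
  rw [← gu_not]
  exact hR.tst_mul_gu_of_le (fun α ha => by simp [BExp.eval, h α ha]) _ _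

/-- By `u1` each side is its own guarded union along `b`, and the branches may be restricted to `b`
and its negation. -/
theorem ext_tst (b : BExp T) {x y : hR.Quo} (h : hR.tst b * x = hR.tst b * y)
    (h' : hR.tst (.not b) * x = hR.tst (.not b) * y) : x = y := by
  rw [← hR.gu_self b x, ← hR.gu_self b y, ← gu_tst_left, ← gu_tst_right, h, h',
    gu_tst_left, gu_tst_right]

section Atoms

variable [Finite T]

/-- The class of the test that is true under one atom only. -/
noncomputable def atom (α : Atom T) : hR.Quo := hR.tst α.toBExp

theorem atom_mul_tst (α : Atom T) (b : BExp T) :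
    hR.atom α * hR.tst b = if b.eval α = true then hR.atom α else 0 := by
  rw [atom, tst_mul_tst]
  split_ifs with h
  · refine hR.tst_congr fun β => ?_
    rw [Bool.eq_iff_iff]
    simp only [BExp.eval, Bool.and_eq_true, Atom.eval_toBExp, and_iff_left_iff_imp]
    rintro rfl; exact h
  · refine hR.tst_eq_zero fun β => ?_
    rw [← Bool.not_eq_true]
    simp only [BExp.eval, Bool.and_eq_true, Atom.eval_toBExp, not_and]
    rintro rfl; exact h

theorem atom_mul_gu_pos {α : Atom T} {b : BExp T} (h : b.eval α = true) (x y : hR.Quo) :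
    hR.atom α * hR.gu b x y = hR.atom α * x :=
  hR.tst_mul_gu_of_le (fun β hβ => by rwa [(α.eval_toBExp β).1 hβ]) x y

theorem atom_mul_gu_neg {α : Atom T} {b : BExp T} (h : b.eval α = false) (x y : hR.Quo) :
    hR.atom α * hR.gu b x y = hR.atom α * y :=
  hR.tst_mul_gu_of_le_not (fun β hβ => by rwa [(α.eval_toBExp β).1 hβ]) x y

/-- Two classes agree if they agree after restriction to every atom. -/
theorem ext_atom {x y : hR.Quo} (h : ∀ α, hR.atom α * x = hR.atom α * y) : x = y := by
  classical
  have := Fintype.ofFinite T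
  -- Generalizing from `1` to any test supported on `s` lets the induction split off one atom at a
  -- time.
  suffices H : ∀ (s : Finset (Atom T)) (b : BExp T), (∀ α, b.eval α = true → α ∈ s) →
      hR.tst b * x = hR.tst b * y by
    simpa [tst_one] using H Finset.univ .one (by simp)
  intro s
  induction s using Finset.induction_on with
  | empty =>
    intro b hb
    rw [hR.tst_eq_zero (b := b) (fun α => by simpa using hb α), zero_mul, zero_mul]
  | insert α s _ ih =>
    intro b hb
    refine hR.ext_tst α.toBExp ?_ ?_
    · change hR.atom α * _ = hR.atom α * _
      rw [← mul_assoc, ← mul_assoc, atom_mul_tst]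
      split_ifs
      · exact h α
      · rw [zero_mul, zero_mul]
    · rw [← mul_assoc, ← mul_assoc, tst_mul_tst]
      refine ih _ fun β hβ => ?_
      simp only [BExp.eval, Bool.and_eq_true, Bool.not_eq_true', ← Bool.not_eq_true,
        Atom.eval_toBExp] at hβ
      exact (Finset.mem_insert.1 (hb β hβ.2)).resolve_left hβ.1

end Atoms

end IsGKATCongruence

/-! ### Derivatives -/

/-- What a program may do from an atom. -/
inductive Outcome (A : Type u) (X : Type v) : Type (max u v)
  | reject : Outcome A X
  | accept : Outcome A X
  | step (p : A) (x : X) : Outcome A X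

open Classical in
/-- The syntactic derivative of an expression with respect to an atom. -/
noncomputable def Exp.deriv (α : Atom T) : Exp A T → Outcome A (Exp A T)
  | .act p => .step p (.test .one)
  | .test b => if b.eval α = true then .accept else .reject
  | .seq e f =>
    match e.deriv α with
    | .reject => .reject
    | .accept => f.deriv α
    | .step p e' => .step p (.seq e' f)
  | .cond b e f => if b.eval α = true then e.deriv α else f.deriv α
  | .loop b e =>
    if b.eval α = true then
      match e.deriv α with
      | .reject => .reject
      -- A body that skips at `α` leaves the guard true at `α`, so the loop never terminates from
      -- there.
      | .accept => .reject
      | .step p e' => .step p (.seq e' (.loop b e))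
    else .accept

/-- The expression described by an outcome with `s x` substituted for the successor `x`. -/
def Outcome.toExp {X : Type*} (s : X → Exp A T) : Outcome A X → Exp A T
  | .reject => .test .zero
  | .accept => .test .one
  | .step p x => .seq (.act p) (s x)

/-- Only finitely many expressions arise by iterated derivatives. -/
theorem Exp.exists_finite_deriv_closed (e : Exp A T) :
    ∃ S : Set (Exp A T), S.Finite ∧ e ∈ S ∧
      ∀ f ∈ S, ∀ α p g, f.deriv α = .step p g → g ∈ S := by
  induction e with
  | act p =>
    refine ⟨{.act p, .test .one}, by simp, by simp, ?_⟩
    rintro f (rfl | rfl) α q g h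
    · simp only [Exp.deriv, Outcome.step.injEq] at h
      simp [← h.2]
    · simp [Exp.deriv, BExp.eval] at h
  | test b =>
    refine ⟨{.test b}, by simp, by simp, ?_⟩
    rintro f rfl α q g h
    simp only [Exp.deriv] at h
    split_ifs at h
  | seq e f ihe ihf =>
    obtain ⟨S, hS, heS, hcS⟩ := ihe
    obtain ⟨S', hS', hfS', hcS'⟩ := ihf
    refine ⟨(fun e' => .seq e' f) '' S ∪ S', (hS.image _).union hS',
      .inl ⟨e, heS, rfl⟩, ?_⟩
    rintro _ (⟨e', he', rfl⟩ | hf') α p g h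
    · simp only [Exp.deriv] at h
      split at h
      · cases h
      · exact .inr (hcS' f hfS' α p g h)
      · rename_i q e'' heq
        cases h
        exact .inl ⟨e'', hcS e' he' α _ _ heq, rfl⟩
    · exact .inr (hcS' _ hf' α p g h)
  | cond b e f ihe ihf =>
    obtain ⟨S, hS, heS, hcS⟩ := ihe
    obtain ⟨S', hS', hfS', hcS'⟩ := ihf
    refine ⟨insert (.cond b e f) (S ∪ S'), (hS.union hS').insert _, .inl rfl, ?_⟩
    rintro _ (rfl | he' | hf') α p g h
    · simp only [Exp.deriv] at h
      split_ifs at h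
      · exact .inr (.inl (hcS _ heS α p g h))
      · exact .inr (.inr (hcS' _ hfS' α p g h))
    · exact .inr (.inl (hcS _ he' α p g h))
    · exact .inr (.inr (hcS' _ hf' α p g h))
  | loop b e ih =>
    obtain ⟨S, hS, heS, hcS⟩ := ih
    -- The tail `.loop b e` is never duplicated: a body derivative that accepts hands over to the
    -- loop itself, whose derivatives again have the form `e' · loop`.
    have hloop : ∀ α p g, (Exp.loop b e).deriv α = .step p g →
        g ∈ (fun e' => Exp.seq e' (.loop b e)) '' S := by
      intro α p g h
      simp only [Exp.deriv] at h
      split_ifs at h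
      split at h
      · cases h
      · cases h
      · rename_i q e' heq
        cases h
        exact ⟨e', hcS e heS α _ _ heq, rfl⟩
    refine ⟨insert (.loop b e) ((fun e' => .seq e' (.loop b e)) '' S), (hS.image _).insert _,
      .inl rfl, ?_⟩
    rintro _ (rfl | ⟨e', he', rfl⟩) α p g h
    · exact .inr (hloop α p g h)
    · rw [Exp.deriv] at h
      split at h
      · cases h
      · exact .inr (hloop α p g h)
      · rename_i q e'' heq
        cases h
        exact .inr ⟨e'', hcS e' he' α _ _ heq, rfl⟩

/-- Restricted to an atom, every expression equals its derivative. -/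
theorem IsGKATCongruence.atom_mul_cls [Finite T] (hR : IsGKATCongruence R) (α : Atom T)
    (e : Exp A T) : hR.atom α * hR.cls e = hR.atom α * hR.cls ((e.deriv α).toExp id) := by
  induction e with
  | act p => simp [Exp.deriv, Outcome.toExp, cls_seq, cls_test, tst_one]
  | test b =>
    rw [cls_test, atom_mul_tst]
    by_cases h : b.eval α = true <;>
      simp [Exp.deriv, Outcome.toExp, cls_test, tst_one, tst_zero, h]
  | seq e f ihe ihf =>
    rw [cls_seq, ← mul_assoc, ihe, Exp.deriv]
    cases e.deriv α with
    | reject => simp [Outcome.toExp, cls_test, tst_zero]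
    | accept => exact (congrArg (· * hR.cls f) (mul_one (hR.atom α))).trans ihf
    | step p e' => simp [Outcome.toExp, cls_seq, mul_assoc]
  | cond b e f ihe ihf =>
    rw [cls_cond, Exp.deriv]
    split_ifs with h
    · rw [hR.atom_mul_gu_pos h, ihe]
    · rw [hR.atom_mul_gu_neg (by simpa using h), ihf]
  | loop b e ih =>
    have unfold_loop : ∀ f : Exp A T, hR.cls (.loop b f) =
        hR.gu b (hR.cls f * hR.cls (.loop b f)) 1 := fun f => hR.cls_eq_cls.2 (hR.w1 b f)
    rw [Exp.deriv]
    split_ifs with h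
    · cases hd : e.deriv α with
      | reject =>
        rw [unfold_loop, hR.atom_mul_gu_pos h, ← mul_assoc, ih, hd]
        simp [Outcome.toExp, cls_test, tst_zero]
      | step p e' =>
        rw [unfold_loop, hR.atom_mul_gu_pos h, ← mul_assoc, ih, hd]
        simp [Outcome.toExp, cls_seq, mul_assoc]
      | accept =>
        -- The body skips at `α`, so the loop equals the one whose body fails there.
        have hα : α.toBExp.eval α = true := (α.eval_toBExp α).2 rfl
        have hbody : hR.cls e = hR.cls (.cond (.not α.toBExp) e (.test .one)) := by
          refine hR.ext_tst α.toBExp ?_ ?_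
          · change hR.atom α * _ = hR.atom α * _
            rw [cls_cond, hR.atom_mul_gu_neg (by simp [BExp.eval, hα]), ih, hd]
            rfl
          · rw [cls_cond, tst_mul_gu_self]
        have hloop : hR.cls (.loop b e) = hR.cls (.loop b (.seq (.test (.not α.toBExp)) e)) :=
          (hR.cls_eq_cls.2 (hR.loop_congr (hR.cls_eq_cls.1 hbody))).trans
            (hR.cls_eq_cls.2 (hR.w2 b _ e))
        rw [hloop, unfold_loop, hR.atom_mul_gu_pos h, cls_seq, cls_test, ← mul_assoc,
          ← mul_assoc, atom_mul_tst]
        simp [BExp.eval, hα, Outcome.toExp, cls_test, tst_zero]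
    · rw [unfold_loop, hR.atom_mul_gu_neg (by simpa using h)]
      rfl

/-! ### Derivatives and the language model -/

theorem Lang.ofAtom_mem_ofAtoms {B : Set (Atom T)} {α : Atom T} {s : List (A × Atom T)} :
    (⟨α, s⟩ : GString A T) ∈ Lang.ofAtoms B ↔ α ∈ B ∧ s = [] := by
  constructor
  · rintro ⟨β, hβ, h⟩
    cases h
    exact ⟨hβ, rfl⟩
  · rintro ⟨h, rfl⟩
    exact ⟨α, h, rfl⟩

theorem Lang.mem_ofAtoms_fusion {B : Set (Atom T)} {L : Lang A T} {w : GString A T} :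
    w ∈ (Lang.ofAtoms B).fusion L ↔ w.first ∈ B ∧ w ∈ L := by
  constructor
  · rintro ⟨_, ⟨β, hβ, rfl⟩, y, hy, hlast, rfl⟩
    obtain rfl : β = y.first := hlast
    exact ⟨hβ, hy⟩
  · rintro ⟨h, h'⟩
    exact ⟨.ofAtom w.first, ⟨_, h, rfl⟩, w, h', rfl, rfl⟩

theorem GString.last_append (x y : GString A T) (h : x.last = y.first) :
    (⟨x.first, x.steps ++ y.steps⟩ : GString A T).last = y.last := by
  simp only [GString.last, List.foldl_append] at h ⊢
  rw [h]

theorem Lang.fusion_assoc (L K M : Lang A T) :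
    (L.fusion K).fusion M = L.fusion (K.fusion M) := by
  ext w
  constructor
  · rintro ⟨_, ⟨x, hx, y, hy, hxy, rfl⟩, z, hz, hyz, rfl⟩
    rw [GString.last_append x y hxy] at hyz
    exact ⟨x, hx, _, ⟨y, hy, z, hz, hyz, rfl⟩, hxy, by simp⟩
  · rintro ⟨x, hx, _, ⟨y, hy, z, hz, hyz, rfl⟩, hxy, rfl⟩
    refine ⟨_, ⟨x, hx, y, hy, hxy, rfl⟩, z, hz, ?_, by simp⟩
    rw [GString.last_append x y hxy, hyz]

/-- Powers grow on the right by definition, whereas derivatives read a loop from the left. -/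
theorem Lang.power_succ' (L : Lang A T) (n : ℕ) :
    L.power (n + 1) = L.fusion (L.power n) := by
  induction n with
  | zero =>
    ext w
    constructor
    · intro h
      exact ⟨w, (Lang.mem_ofAtoms_fusion.1 h).2, .ofAtom w.last, ⟨_, trivial, rfl⟩, rfl,
        by simp [GString.ofAtom]⟩
    · rintro ⟨x, hx, _, ⟨β, -, rfl⟩, -, rfl⟩
      exact Lang.mem_ofAtoms_fusion.2 ⟨trivial, by simpa [GString.ofAtom] using hx⟩
  | succ n ih =>
    calc (L.power (n + 1)).fusion L = L.fusion ((L.power n).fusion L) := by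
          rw [ih, Lang.fusion_assoc]
      _ = L.fusion (L.power (n + 1)) := rfl

/-- The `n`-fold iterations that make up a guarded loop. -/
def Lang.iter (B : Set (Atom T)) (L : Lang A T) (n : ℕ) : Lang A T :=
  (((Lang.ofAtoms B).fusion L).power n).fusion (Lang.ofAtoms Bᶜ)

theorem Lang.mem_loop {B : Set (Atom T)} {L : Lang A T} {w : GString A T} :
    w ∈ Lang.loop B L ↔ ∃ n, w ∈ Lang.iter B L n := Set.mem_iUnion

theorem Lang.mem_iter_zero {B : Set (Atom T)} {L : Lang A T} {α : Atom T}
    {s : List (A × Atom T)} :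
    (⟨α, s⟩ : GString A T) ∈ Lang.iter B L 0 ↔ α ∉ B ∧ s = [] := by
  rw [Lang.iter, Lang.power, Lang.mem_ofAtoms_fusion, Lang.ofAtom_mem_ofAtoms]
  simp

theorem Lang.mem_iter_succ {B : Set (Atom T)} {L : Lang A T} {n : ℕ} {w : GString A T} :
    w ∈ Lang.iter B L (n + 1) ↔ w.first ∈ B ∧ w ∈ L.fusion (Lang.iter B L n) := by
  rw [Lang.iter, Lang.power_succ', Lang.fusion_assoc, Lang.fusion_assoc,
    Lang.mem_ofAtoms_fusion, Lang.iter]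

/-- The guarded strings starting with `α` that are described by an outcome at `α`. -/
def Outcome.Accepts : Outcome A (Exp A T) → List (A × Atom T) → Prop
  | .reject, _ => False
  | .accept, s => s = []
  | .step p e, s => ∃ β r, s = (p, β) :: r ∧ (⟨β, r⟩ : GString A T) ∈ e.sem

/-- Here and in the next two lemmas, `h` is the induction hypothesis of `Exp.mem_sem_iff`, and `K`
is arbitrary so as to cover both sequencing and the passes of a loop. -/
theorem Lang.fusion_of_reject {e : Exp A T} {α : Atom T} {K : Lang A T}
    (h : ∀ s, (⟨α, s⟩ : GString A T) ∈ e.sem ↔ Outcome.Accepts .reject s)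
    (s : List (A × Atom T)) : (⟨α, s⟩ : GString A T) ∉ e.sem.fusion K := by
  rintro ⟨⟨_, r⟩, hx, y, hy, hxy, heq⟩
  cases heq
  exact (h r).1 hx

theorem Lang.fusion_of_accept {e : Exp A T} {α : Atom T} {K : Lang A T}
    (h : ∀ s, (⟨α, s⟩ : GString A T) ∈ e.sem ↔ Outcome.Accepts .accept s)
    (s : List (A × Atom T)) :
    (⟨α, s⟩ : GString A T) ∈ e.sem.fusion K ↔ (⟨α, s⟩ : GString A T) ∈ K := by
  constructor
  · rintro ⟨⟨_, r⟩, hx, ⟨β, s⟩, hy, hxy, heq⟩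
    cases heq
    obtain rfl : r = [] := (h r).1 hx
    obtain rfl : _ = β := hxy
    exact hy
  · intro hs
    exact ⟨⟨α, []⟩, (h []).2 rfl, ⟨α, s⟩, hs, rfl, rfl⟩

theorem Lang.fusion_of_step {e e' : Exp A T} {p : A} {α : Atom T} {K : Lang A T}
    (h : ∀ s, (⟨α, s⟩ : GString A T) ∈ e.sem ↔ Outcome.Accepts (.step p e') s)
    (s : List (A × Atom T)) :
    (⟨α, s⟩ : GString A T) ∈ e.sem.fusion K ↔
      ∃ β r, s = (p, β) :: r ∧ (⟨β, r⟩ : GString A T) ∈ e'.sem.fusion K := by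
  constructor
  · rintro ⟨⟨_, r⟩, hx, y, hy, hxy, heq⟩
    cases heq
    obtain ⟨β, r', rfl, hr'⟩ := (h r).1 hx
    exact ⟨β, _, rfl, ⟨β, r'⟩, hr', y, hy, hxy, rfl⟩
  · rintro ⟨β, _, rfl, ⟨_, r⟩, hx, y, hy, hxy, heq⟩
    cases heq
    exact ⟨⟨α, (p, _) :: r⟩, (h _).2 ⟨_, r, rfl, hx⟩, y, hy, hxy, rfl⟩

/-- Derivatives compute the language semantics. -/
theorem Exp.mem_sem_iff (e : Exp A T) (α : Atom T) (s : List (A × Atom T)) :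
    (⟨α, s⟩ : GString A T) ∈ e.sem ↔ (e.deriv α).Accepts s := by
  induction e generalizing s with
  | act p =>
    simp only [Exp.sem, Exp.deriv, Outcome.Accepts, Lang.ofAtom_mem_ofAtoms]
    constructor
    · rintro ⟨_, β, h⟩
      cases h
      exact ⟨β, [], rfl, rfl, rfl⟩
    · rintro ⟨β, r, rfl, -, rfl⟩
      exact ⟨α, β, rfl⟩
  | test b =>
    rw [Exp.sem, Exp.deriv, Lang.ofAtom_mem_ofAtoms]
    split_ifs with h <;> simp [Outcome.Accepts, BExp.atoms, h]
  | seq e f ihe ihf =>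
    rw [Exp.sem, Exp.deriv]
    cases hd : e.deriv α with
    | reject =>
      rw [hd] at ihe
      simpa [Outcome.Accepts] using Lang.fusion_of_reject ihe s
    | accept =>
      rw [hd] at ihe
      rw [Lang.fusion_of_accept ihe, ihf]
    | step p e' =>
      rw [hd] at ihe
      rw [Lang.fusion_of_step ihe]
      rfl
  | cond b e f ihe ihf =>
    rw [Exp.sem, Exp.deriv, Lang.cond, Set.mem_union, Lang.mem_ofAtoms_fusion,
      Lang.mem_ofAtoms_fusion, ihe, ihf]
    split_ifs with h <;> simp [BExp.atoms, h]
  | loop b e ih =>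
    rw [Exp.deriv]
    split_ifs with h
    · have hmem : (⟨α, s⟩ : GString A T) ∈ (Exp.loop b e).sem ↔
          (⟨α, s⟩ : GString A T) ∈ e.sem.fusion (Exp.loop b e).sem := by
        rw [Exp.sem, Lang.mem_loop]
        constructor
        · rintro ⟨_ | n, hn⟩
          · exact absurd h (Lang.mem_iter_zero.1 hn).1
          · obtain ⟨-, x, hx, y, hy, hxy⟩ := Lang.mem_iter_succ.1 hn
            exact ⟨x, hx, y, Lang.mem_loop.2 ⟨n, hy⟩, hxy⟩
        · rintro ⟨x, hx, y, hy, hxy⟩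
          obtain ⟨n, hn⟩ := Lang.mem_loop.1 hy
          exact ⟨n + 1, Lang.mem_iter_succ.2 ⟨h, x, hx, y, hn, hxy⟩⟩
      cases hd : e.deriv α with
      | reject =>
        rw [hd] at ih
        rw [hmem]
        simpa [Outcome.Accepts] using Lang.fusion_of_reject ih s
      | accept =>
        rw [hd] at ih
        -- Every pass ends where it began, at `α`, where the guard holds, so no number of passes
        -- reaches the exit.
        have hempty : ∀ n, (⟨α, s⟩ : GString A T) ∉ Lang.iter b.atoms e.sem n := by
          intro n
          induction n with
          | zero => exact fun hn => (Lang.mem_iter_zero.1 hn).1 h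
          | succ n ihn =>
            rw [Lang.mem_iter_succ, Lang.fusion_of_accept ih]
            exact fun hn => ihn hn.2
        simpa [Exp.sem, Lang.mem_loop, Outcome.Accepts] using hempty
      | step p e' =>
        rw [hd] at ih
        rw [hmem, Lang.fusion_of_step ih]
        rfl
    · rw [Exp.sem, Lang.mem_loop]
      constructor
      · rintro ⟨_ | n, hn⟩
        · exact (Lang.mem_iter_zero.1 hn).2
        · exact absurd (Lang.mem_iter_succ.1 hn).1 h
      · intro hs
        exact ⟨0, Lang.mem_iter_zero.2 ⟨h, hs⟩⟩

/-! ### Bisimulation from the uniqueness axiom -/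

namespace IsGKATCongruence

variable [Finite T] (hR : IsGKATCongruence R)

/-- Evaluation of a chain of guarded unions at an atom below exactly one guard. -/
theorem atom_mul_foldr_pos {ι : Type*} (g : ι → BExp T) (x : ι → Exp A T) (d : Exp A T)
    (α : Atom T) (j : ι) (hj : (g j).eval α = true) (hg : ∀ k, (g k).eval α = true → k = j)
    (l : List ι) (hl : j ∈ l) :
    hR.atom α * hR.cls (l.foldr (fun j acc => .cond (g j) (x j) acc) d) =
      hR.atom α * hR.cls (x j) := by
  induction l with
  | nil => cases hl
  | cons k l ih =>
    rw [List.foldr_cons, cls_cond]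
    by_cases hk : (g k).eval α = true
    · rw [hR.atom_mul_gu_pos hk, hg k hk]
    · rw [hR.atom_mul_gu_neg (by simpa using hk)]
      refine ih ((List.mem_cons.1 hl).resolve_left ?_)
      rintro rfl
      exact hk hj

/-- Evaluation of a chain of guarded unions at an atom below none of the guards. -/
theorem atom_mul_foldr_neg {ι : Type*} (g : ι → BExp T) (x : ι → Exp A T) (d : Exp A T)
    (α : Atom T) (hg : ∀ k, (g k).eval α = false) (l : List ι) :
    hR.atom α * hR.cls (l.foldr (fun j acc => .cond (g j) (x j) acc) d) =
      hR.atom α * hR.cls d := by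
  induction l with
  | nil => rfl
  | cons k l ih => rw [List.foldr_cons, cls_cond, hR.atom_mul_gu_neg (hg k), ih]

end IsGKATCongruence

/-- There are finitely many atoms, so the disjunction of the tests for the atoms in `P` serves. It
supplies the guards and constants of the system below. -/
theorem BExp.exists_eval_iff [Finite T] (P : Atom T → Prop) :
    ∃ b : BExp T, ∀ α, b.eval α = true ↔ P α := by
  classical
  have := Fintype.ofFinite T
  suffices h : ∀ s : Finset (Atom T), ∃ b : BExp T, ∀ α, b.eval α = true ↔ α ∈ s by
    obtain ⟨b, hb⟩ := h (Finset.univ.filter P)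
    exact ⟨b, fun α => by simp [hb]⟩
  intro s
  induction s using Finset.induction_on with
  | empty => exact ⟨.zero, by simp [BExp.eval]⟩
  | insert α s _ ih =>
    obtain ⟨b, hb⟩ := ih
    exact ⟨.or α.toBExp b, fun β => by simp [BExp.eval, hb, Atom.eval_toBExp]⟩

/-- Two solutions of a finite deterministic automaton agree. The variables of the system are
pairs of an atom and a state, so that each coefficient is a single action. -/
theorem UniquenessAxiom.eq_of_automaton [Finite T] (hU : UniquenessAxiom R)
    (hR : IsGKATCongruence R) {ι : Type*} [Finite ι] (out : ι → Atom T → Outcome A ι)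
    (s s' : ι → Exp A T)
    (hs : ∀ i α, hR.atom α * hR.cls (s i) = hR.atom α * hR.cls ((out i α).toExp s))
    (hs' : ∀ i α, hR.atom α * hR.cls (s' i) = hR.atom α * hR.cls ((out i α).toExp s'))
    (i : ι) : hR.cls (s i) = hR.cls (s' i) := by
  classical
  obtain ⟨n, ⟨φ⟩⟩ := Finite.exists_equiv_fin (Atom T × ι)
  choose c hc using fun i => BExp.exists_eval_iff fun α => out i α = .accept
  -- The guard in column `(α, j)` holds at most at `α`, and only if the state steps to `j` there.
  -- Determinism makes distinct columns disjoint.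
  choose g hg using fun (i : ι) (m : Atom T × ι) =>
    BExp.exists_eval_iff fun α => m.1 = α ∧ ∃ p, out i α = .step p m.2
  -- Without a step the guard is false; the filler `0` keeps the system Salomaa.
  let coeff : ι → Atom T × ι → Exp A T := fun i m =>
    match out i m.1 with
    | .step p _ => .act p
    | _ => .test .zero
  -- The row of `(α, i)` depends on `i` only: the atom merely separates columns.
  let st : Fin n → ι := fun k => (φ.symm k).2
  let S : LeftAffineSystem A T n :=
    { coeff := fun k l => coeff (st k) (φ.symm l)
      guard := fun k l => g (st k) (φ.symm l)
      const := fun k => c (st k)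
      guard_disjoint := by
        intro k l m hlm
        refine .of_eval fun α => ?_
        change _ = false
        rw [← Bool.not_eq_true]
        intro h
        simp only [BExp.eval, Bool.and_eq_true, hg] at h
        obtain ⟨⟨h1, p, h2⟩, h3, q, h4⟩ := h
        rw [h2] at h4
        injection h4 with _ h5
        exact hlm (φ.symm.injective (Prod.ext (h1.trans h3.symm) h5))
      const_disjoint := by
        intro k l
        refine .of_eval fun α => ?_
        change _ = false
        rw [← Bool.not_eq_true]
        intro h
        simp only [BExp.eval, Bool.and_eq_true, hg, hc] at h
        obtain ⟨⟨-, p, h2⟩, h3⟩ := h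
        rw [h2] at h3
        cases h3 }
  have hSal : S.IsSalomaa R := by
    intro k l
    have : (S.coeff k l).E = .zero := by
      change (coeff _ _).E = _
      simp only [coeff]
      split <;> rfl
    rw [this]
    exact hR.equivalence.refl _
  -- At an atom `α` where the state steps to `j`, only column `(α, j)` fires; where it does not
  -- step, no column fires and the constant decides.
  have hsol : ∀ t : ι → Exp A T,
      (∀ i α, hR.atom α * hR.cls (t i) = hR.atom α * hR.cls ((out i α).toExp t)) →
      S.IsSolution R fun k => t (st k) := by
    intro t ht k
    refine hR.cls_eq_cls.1 (hR.ext_atom fun α => ?_)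
    rw [ht, LeftAffineSystem.rhs]
    cases ho : out (st k) α with
    | reject =>
      have hcα : (c (st k)).eval α ≠ true := by simp [hc, ho]
      rw [hR.atom_mul_foldr_neg (g := S.guard k)
        (x := fun j => .seq (S.coeff k j) (t (st j)))]
      · rw [hR.cls_test, hR.atom_mul_tst, if_neg hcα]
        simp [Outcome.toExp, hR.cls_test, hR.tst_zero]
      · intro l
        rw [← Bool.not_eq_true]
        simp [S, hg, ho]
    | accept =>
      have hcα : (c (st k)).eval α = true := by simp [hc, ho]
      rw [hR.atom_mul_foldr_neg (g := S.guard k)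
        (x := fun j => .seq (S.coeff k j) (t (st j)))]
      · rw [hR.cls_test, hR.atom_mul_tst, if_pos hcα]
        simp [Outcome.toExp, hR.cls_test, hR.tst_one]
      · intro l
        rw [← Bool.not_eq_true]
        simp [S, hg, ho]
    | step p j =>
      rw [hR.atom_mul_foldr_pos (g := S.guard k)
        (x := fun j => .seq (S.coeff k j) (t (st j))) (j := φ (α, j))]
      · have hcoeff : S.coeff k (φ (α, j)) = .act p := by simp [S, coeff, ho]
        simp [Outcome.toExp, hcoeff, st]
      · simp [S, hg, ho]
      · intro l hl
        simp only [S, hg, ho] at hl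
        obtain ⟨h1, q, h2⟩ := hl
        injection h2 with _ h3
        rw [← φ.symm_apply_eq]
        exact Prod.ext h1 h3.symm
      · exact List.mem_finRange _
  obtain ⟨α⟩ : Nonempty (Atom T) := inferInstance
  have := hR.cls_eq_cls.2 (hU n S hSal _ _ (hsol s hs) (hsol s' hs') (φ (α, i)))
  simpa [st] using this

/-- A finite relation is contained in the congruence if related expressions have, up to the
congruence, the same behaviour at every atom. -/
theorem UniquenessAxiom.eq_of_bisimulation [Finite T] (hU : UniquenessAxiom R)
    (hR : IsGKATCongruence R) (P : Set (Exp A T × Exp A T)) (hP : P.Finite)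
    (h : ∀ m ∈ P, ∀ α,
      (hR.atom α * hR.cls m.1 = 0 ∧ hR.atom α * hR.cls m.2 = 0) ∨
      (hR.atom α * hR.cls m.1 = hR.atom α ∧ hR.atom α * hR.cls m.2 = hR.atom α) ∨
      ∃ p, ∃ m' ∈ P, hR.atom α * hR.cls m.1 = hR.atom α * (hR.cls (.act p) * hR.cls m'.1) ∧
        hR.atom α * hR.cls m.2 = hR.atom α * (hR.cls (.act p) * hR.cls m'.2))
    {e f : Exp A T} (hef : (e, f) ∈ P) : hR.cls e = hR.cls f := by
  have : Finite P := hP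
  -- The pairs are the states of one automaton, which the first and the second components both
  -- solve.
  have key : ∀ (m : P) (α : Atom T), ∃ o : Outcome A P,
      hR.atom α * hR.cls m.1.1 =
        hR.atom α * hR.cls (o.toExp fun m : P => m.1.1) ∧
      hR.atom α * hR.cls m.1.2 =
        hR.atom α * hR.cls (o.toExp fun m : P => m.1.2) := by
    intro m α
    rcases h m.1 m.2 α with ⟨h1, h2⟩ | ⟨h1, h2⟩ | ⟨p, m', hm', h1, h2⟩
    · refine ⟨.reject, ?_⟩
      simp [Outcome.toExp, h1, h2, hR.cls_test, hR.tst_zero]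
    · refine ⟨.accept, ?_⟩
      simp [Outcome.toExp, h1, h2, hR.cls_test, hR.tst_one]
    · exact ⟨.step p ⟨m', hm'⟩, h1, h2⟩
  choose out h1 h2 using key
  exact hU.eq_of_automaton hR out (fun m : P => m.1.1) (fun m : P => m.1.2) h1 h2 ⟨(e, f), hef⟩

/-! ### Completeness -/

theorem Exp.sem_eq_empty_of_step {e e' : Exp A T} {α : Atom T} {p : A}
    (h : ∀ s, (⟨α, s⟩ : GString A T) ∉ e.sem) (hd : e.deriv α = .step p e') :
    e'.sem = ∅ := by
  refine Set.eq_empty_of_forall_notMem fun ⟨β, r⟩ hr => h ((p, β) :: r) ?_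
  rw [Exp.mem_sem_iff, hd]
  exact ⟨β, r, rfl, hr⟩

/-- The language of `e'` is expressed through `e.sem` alone, so equal languages pass to derivatives.
-/
theorem Exp.exists_step_of_cons_mem {e : Exp A T} {α β : Atom T} {p : A}
    {r : List (A × Atom T)} (h : (⟨α, (p, β) :: r⟩ : GString A T) ∈ e.sem) :
    ∃ e', e.deriv α = .step p e' ∧
      e'.sem = {w | (⟨α, (p, w.first) :: w.steps⟩ : GString A T) ∈ e.sem} := by
  rw [Exp.mem_sem_iff] at h
  cases hd : e.deriv α with
  | reject => rw [hd] at h; exact h.elim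
  | accept => rw [hd] at h; cases h
  | step q e' =>
    rw [hd] at h
    obtain ⟨_, _, heq, -⟩ := h
    cases heq
    refine ⟨e', rfl, Set.ext fun w => ?_⟩
    rw [Set.mem_ofPred_eq, Exp.mem_sem_iff e, hd]
    constructor
    · exact fun hw => ⟨w.first, w.steps, rfl, hw⟩
    · rintro ⟨_, _, heq, hw⟩
      cases heq
      exact hw

theorem Exp.deriv_eq_accept {e : Exp A T} {α : Atom T}
    (h : (⟨α, []⟩ : GString A T) ∈ e.sem) : e.deriv α = .accept := by
  rw [Exp.mem_sem_iff] at h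
  cases hd : e.deriv α with
  | reject => rw [hd] at h; exact h.elim
  | accept => rfl
  | step q e' =>
    rw [hd] at h
    obtain ⟨_, _, heq, -⟩ := h
    cases heq

variable [Finite T]

/-- If no guarded string of `e` starts with `α`, then `e` vanishes at `α`, provided that its
derivative vanishes whenever it has no guarded strings. -/
theorem IsGKATCongruence.atom_mul_cls_eq_zero (hR : IsGKATCongruence R) {e : Exp A T}
    {α : Atom T} (h : ∀ s, (⟨α, s⟩ : GString A T) ∉ e.sem)
    (hstep : ∀ p e', e.deriv α = .step p e' → e'.sem = ∅ → hR.cls e' = 0) :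
    hR.atom α * hR.cls e = 0 := by
  rw [atom_mul_cls]
  cases hd : e.deriv α with
  | reject => simp [Outcome.toExp, cls_test, tst_zero]
  | accept => exact (h [] (by rw [Exp.mem_sem_iff, hd]; rfl)).elim
  | step p e' =>
    -- Axiom `s3` enters through `mul_zero`: acting and then failing equals failing at once.
    rw [Outcome.toExp, id, cls_seq, hstep p e' hd (Exp.sem_eq_empty_of_step h hd), mul_zero, mul_zero]

/-- Expressions without guarded strings are provably equal to `0`. -/
theorem UniquenessAxiom.cls_eq_zero (hU : UniquenessAxiom R) (hR : IsGKATCongruence R)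
    {e : Exp A T} (he : e.sem = ∅) : hR.cls e = 0 := by
  obtain ⟨S, hS, heS, hcl⟩ := e.exists_finite_deriv_closed
  have hz : hR.cls (.test .zero) = 0 := rfl
  rw [← hz]
  -- Derivatives with empty language are paired with `0`, which can match every step because `p · 0
  -- = 0`.
  refine hU.eq_of_bisimulation hR
    ((fun f => (f, .test .zero)) '' {f ∈ S | f.sem = ∅}) ((hS.subset (Set.sep_subset _ _)).image _)
    ?_ ⟨e, ⟨heS, he⟩, rfl⟩
  rintro _ ⟨f, ⟨hfS, hf⟩, rfl⟩ α
  have hne : ∀ s, (⟨α, s⟩ : GString A T) ∉ f.sem := by simp [hf]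
  simp only [hz, mul_zero, hR.atom_mul_cls α f]
  cases hd : f.deriv α with
  | reject => exact .inl ⟨by simp [Outcome.toExp, hz], trivial⟩
  | accept => exact (hne [] (by rw [Exp.mem_sem_iff, hd]; rfl)).elim
  | step p f' =>
    exact .inr (.inr ⟨p, _, ⟨f', ⟨hcl f hfS α p f' hd, Exp.sem_eq_empty_of_step hne hd⟩, rfl⟩,
      rfl, by simp [hz]⟩)

/-- A congruence that satisfies the GKAT axioms and the uniqueness axiom identifies expressions
with the same language. -/
theorem UniquenessAxiom.complete (hU : UniquenessAxiom R) (hR : IsGKATCongruence R)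
    {e₁ e₂ : Exp A T} (h : e₁.sem = e₂.sem) : R e₁ e₂ := by
  obtain ⟨S₁, hS₁, he₁, hcl₁⟩ := e₁.exists_finite_deriv_closed
  obtain ⟨S₂, hS₂, he₂, hcl₂⟩ := e₂.exists_finite_deriv_closed
  refine hR.cls_eq_cls.1 (hU.eq_of_bisimulation hR {m ∈ S₁ ×ˢ S₂ | m.1.sem = m.2.sem}
    ((hS₁.prod hS₂).subset (Set.sep_subset _ _)) ?_ ⟨⟨he₁, he₂⟩, h⟩)
  rintro ⟨e, f⟩ ⟨⟨he, hf⟩, hef : e.sem = f.sem⟩ α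
  -- If no string starts at `α`, the two derivatives need not match, but both sides vanish at `α`.
  by_cases hα : ∀ s, (⟨α, s⟩ : GString A T) ∉ e.sem
  · exact .inl ⟨hR.atom_mul_cls_eq_zero hα fun _ _ _ => hU.cls_eq_zero hR,
      hR.atom_mul_cls_eq_zero (hef ▸ hα) fun _ _ _ => hU.cls_eq_zero hR⟩
  push Not at hα
  obtain ⟨s, hs⟩ := hα
  have hs' := hs
  rw [hef] at hs'
  refine .inr ?_
  rw [hR.atom_mul_cls α e, hR.atom_mul_cls α f]
  -- By determinism one common string fixes the outcome at `α` on both sides: acceptance if it is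
  -- just `α`, otherwise a step with its first action.
  rcases s with _ | ⟨⟨p, β⟩, r⟩
  · rw [Exp.deriv_eq_accept hs, Exp.deriv_eq_accept hs']
    exact .inl ⟨mul_one _, mul_one _⟩
  · obtain ⟨e', hd, hsem⟩ := Exp.exists_step_of_cons_mem hs
    obtain ⟨f', hd', hsem'⟩ := Exp.exists_step_of_cons_mem hs'
    rw [hd, hd']
    exact .inr ⟨p, (e', f'), ⟨⟨hcl₁ e he α p e' hd, hcl₂ f hf α p f' hd'⟩,
      by rw [hsem, hsem', hef]⟩, rfl, rfl⟩

end GKAT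

/-- Completeness of the GKAT axioms with the uniqueness axiom for the language model. The first
part takes the uniqueness axiom as a further rule of the axiomatization; the second part takes it
as an assumption on the congruence generated by the GKAT axioms alone. -/
theorem mainTheorem1 {A T : Type*} [Finite T] :
    (∀ e₁ e₂ : GKAT.Exp A T, e₁.sem = e₂.sem → GKAT.GEquivUA e₁ e₂) ∧
    (GKAT.UniquenessAxiom (GKAT.GEquiv (A := A) (T := T)) →
      ∀ e₁ e₂ : GKAT.Exp A T, e₁.sem = e₂.sem → GKAT.GEquiv e₁ e₂) :=
  ⟨fun _ _ h _ hR hU => hU.complete hR h,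
    fun hU _ _ h => hU.complete GKAT.isGKATCongruence_gEquiv h⟩
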